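/- Let $1\le k\le m$ and $L\ge 1$ be integers and $d>0$, $\rho<1$, $0<\varepsilon\le 0.2$, $0<\delta\le 0.05$ real numbers. Let $\mathcal G=([m],E)$ be a simple undirected graph. A data set $D$ on $\mathcal G$ consists of $L$ comparison outcomes $y^{(1)}_{i,j},\dots,y^{(L)}_{i,j}\in\{0,1\}$ for every edge $(i,j)\in E$, with $y^{(l)}_{j,i}=1-y^{(l)}_{i,j}$. Two data sets on $\mathcal G$ are adjacent if they differ in exactly one sample of one edge. Put $y_{i,j}=\frac1L\sum_{l=1}^L y^{(l)}_{i,j}$ and let $P=P(D)$ be the $m\times m$ matrix with $P_{ij}=\frac1d y_{i,j}$ if $(i,j)\in E$, $P_{ii}=1-\frac1d\sum_{k':(i,k')\in E}y_{i,k'}$, and $P_{ij}=0$ otherwise. A stationary distribution of $P$ is a probability vector $\pi$ with $\pi^\top P=\pi^\top$. The data set $D$ is called $\rho$-constrained if $P$ has a unique stationary distribution and its ergodicity coefficient $\tau_1(P)=\sup\{\|v^\top P\|_1:\ \|v\|_1=1,\ \sum_i v_i=0\}$ (read as $0$ if $m=1$) is at most $\rho$. The oneshot spectral method with noise scale $\lambda$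 computes the stationary distribution $\pi$ of $P(D)$, adds independent Laplace noise $g_i$ with density $\frac{1}{2\lambda}e^{-|z|/\lambda}$ to each $-\pi_i$, sorts the noisy values from low to high, and returns the set $\mathcal M(D)=\{i_1,\dots,i_k\}$ of the indices of the $k$ smallest ones. Suppose that $$\lambda\ \ge\ \frac{8s\sqrt{k\log(m/\delta)}}{\varepsilon},\qquad s=\frac{2}{dL(1-\rho)}.$$ Then the method is $(\varepsilon,\delta)$-differentially private: for all adjacent data sets $D,D'$ on $\mathcal G$ for which the stationary distributions are unique and at least one of which is $\rho$-constrained (in particular, for all adjacent $\rho$-constrained $D,D'$), and for every set $S$ of subsets of $[m]$, $$\mathbb P(\mathcal M(D)\in S)\ \le\ e^{\varepsilon}\,\mathbb P(\mathcal M(D')\in S)+\delta .$$ -/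

import Mathlib

open scoped Matrix

noncomputable section

/-! ### Approximate differential privacy -/

/-- A randomized mechanism is a function `M` of the data set and of a random seed `ω` with
distribution `P`. It is `(ε, δ)`-differentially private for the adjacency relation `adj` if
`ℙ(M D ∈ S) ≤ e ^ ε * ℙ(M D' ∈ S) + δ` for all adjacent `D`, `D'` and all sets `S` of outputs. -/
def IsDifferentiallyPrivate {Data Ω Out : Type*} [MeasurableSpace Ω]
    (P : MeasureTheory.Measure Ω) (adj : Data → Data → Prop) (M : Data → Ω → Out)
    (ε δ : ℝ) : Prop :=
  ∀ D D' : Data, adj D D' → ∀ S : Set Out,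
    P {ω | M D ω ∈ S} ≤
      ENNReal.ofReal (Real.exp ε) * P {ω | M D' ω ∈ S} + ENNReal.ofReal δ

/-! ### The oneshot Laplace mechanism -/

/-- The Laplace distribution of scale `lam`, with density `exp (-|z| / lam) / (2 * lam)`. -/
def laplace (lam : ℝ) : MeasureTheory.Measure ℝ :=
  MeasureTheory.volume.withDensity
    (fun z => ENNReal.ofReal (1 / (2 * lam) * Real.exp (-|z| / lam)))

/-- The noise used by the oneshot mechanism: the selection noise `g` and the fresh noise `g'`,
all `2 * m` coordinates being independent with Laplace distribution of scale `lam`. -/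
def oneshotNoise (m : ℕ) (lam : ℝ) : MeasureTheory.Measure ((Fin m → ℝ) × (Fin m → ℝ)) :=
  (MeasureTheory.Measure.pi fun _ => laplace lam).prod
    (MeasureTheory.Measure.pi fun _ => laplace lam)

/-- The oneshot Laplace mechanism on the values `x`: sort the noisy values `x i + g i` from low
to high, and return the first `k` indices, each with the value there, perturbed by the fresh
noise. -/
def oneshot {m k : ℕ} (hk : k ≤ m) (x : Fin m → ℝ) (ω : (Fin m → ℝ) × (Fin m → ℝ)) :
    Fin k → Fin m × ℝ :=
  fun j =>
    let i := Tuple.sort (fun a => x a + ω.1 a) (Fin.castLE hk j)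
    (i, x i + ω.2 i)

/-! ### Markov chains -/

/-- `π` is a stationary distribution of `P`: a probability vector with `πᵀ P = πᵀ`. -/
def IsStationaryDist {m : ℕ} (P : Matrix (Fin m) (Fin m) ℝ) (π : Fin m → ℝ) : Prop :=
  π ∈ stdSimplex ℝ (Fin m) ∧ π ᵥ* P = π

/-- The stationary distribution of `P` (meaningful if there is exactly one). -/
def stationaryDistribution {m : ℕ} (P : Matrix (Fin m) (Fin m) ℝ) : Fin m → ℝ :=
  Classical.epsilon (IsStationaryDist P)

/-- The ergodicity coefficient `τ₁(A)`, the supremum of `‖vᵀ A‖₁` over the vectors `v` with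
`‖v‖₁ = 1` whose entries sum to zero. -/
def ergodicityCoeff {m : ℕ} (A : Matrix (Fin m) (Fin m) ℝ) : ℝ :=
  sSup {r | ∃ v : Fin m → ℝ, ∑ i, |v i| = 1 ∧ ∑ i, v i = 0 ∧ r = ∑ j, |(v ᵥ* A) j|}

/-! ### Pairwise comparison data -/

/-- Pairwise comparison data on the comparison graph `G`, with `L` comparisons for each edge.
`outcome e l` is the result `y_{i,j}^{(l)}` of the `l`-th comparison along the oriented edge
`e = (i, j)`: it is `true` (that is, `1`) if `j` is preferred over `i`. -/
structure ComparisonData {m : ℕ} (G : SimpleGraph (Fin m)) (L : ℕ) where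
  outcome : G.Dart → Fin L → Bool
  outcome_symm : ∀ e l, outcome e.symm l = !outcome e l

namespace ComparisonData

variable {m : ℕ} {G : SimpleGraph (Fin m)} {L : ℕ}

/-- Two data sets are adjacent if they differ in exactly one sample `l₀` of one edge `e₀`
(which is seen from both orientations of the edge). -/
def Adjacent (D D' : ComparisonData G L) : Prop :=
  ∃ (e₀ : G.Dart) (l₀ : Fin L), ∀ (e : G.Dart) (l : Fin L),
    D.outcome e l ≠ D'.outcome e l ↔ e.edge = e₀.edge ∧ l = l₀

/-- The sufficient statistic `y_{i,j}`, the mean of the `L` outcomes on the edge `(i, j)`. -/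
def mean (D : ComparisonData G L) (e : G.Dart) : ℝ :=
  1 / (L : ℝ) * ∑ l, if D.outcome e l then 1 else 0

open Classical in
/-- The entry `y_{i,j} / d` for `(i, j)` an edge, and `0` otherwise. -/
def offDiag (D : ComparisonData G L) (d : ℝ) (i j : Fin m) : ℝ :=
  if h : G.Adj i j then 1 / d * D.mean ⟨(i, j), h⟩ else 0

/-- The transition matrix of the random walk: `y_{i,j} / d` on the edges, `0` on the other
off-diagonal entries, and `1 - (∑ y_{i,k}) / d` over the neighbours `k` of `i` on the diagonal. -/
def transition (D : ComparisonData G L) (d : ℝ) : Matrix (Fin m) (Fin m) ℝ :=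
  Matrix.of fun i j => if i = j then 1 - ∑ k, D.offDiag d i k else D.offDiag d i j

/-- The transition matrix has a unique stationary distribution. -/
def HasUniqueStationary (D : ComparisonData G L) (d : ℝ) : Prop :=
  ∃! π : Fin m → ℝ, IsStationaryDist (D.transition d) π

/-- The comparison graph with its data is `ρ`-constrained (to be used with `ρ < 1`). -/
def IsConstrained (D : ComparisonData G L) (d ρ : ℝ) : Prop :=
  D.HasUniqueStationary d ∧ ergodicityCoeff (D.transition d) ≤ ρ

/-- The oneshot spectral method: the index set returned by the oneshot Laplace mechanism on the
negated stationary distribution of the transition matrix. -/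
def spectralOneshot {k : ℕ} (hk : k ≤ m) (d : ℝ) (D : ComparisonData G L)
    (ω : (Fin m → ℝ) × (Fin m → ℝ)) : Finset (Fin m) :=
  Finset.univ.image fun j : Fin k =>
    (oneshot hk (fun i => -stationaryDistribution (D.transition d) i) ω j).1

end ComparisonData

end

open MeasureTheory

/-! The method is post-processing of the Laplace mechanism: its output depends only on the noisy
vector. Laplace noise of scale `lam` is (Δ/`lam`)-private for a vector of `ℓ¹` sensitivity Δ
(`oneshotNoise_laplace_mechanism`), so it suffices that Δ ≤ `s` and `s / ε ≤ lam`. The latter holds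
because the factor 8√(k log(m/δ)) is at least 1; in fact pure ε-privacy results, and δ is only added
at the end.

The sensitivity bound is a perturbation argument. From π' - π = π'(P' - P) + (π' - π)P and the
contraction by τ₁(P) on zero-sum vectors, (1 - τ₁(P))‖π' - π‖₁ ≤ ‖π'(P' - P)‖₁. One changed sample
alters each row off the diagonal by at most 1/(dL), and the diagonal compensates, so the right side
is at most 2/(dL). -/

/-- A measure that is dominated on boxes by a multiple of a product measure is dominated by it. -/
theorem Measure.le_smul_pi {ι : Type*} [Fintype ι] {α : ι → Type*} [∀ i, MeasurableSpace (α i)]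
    (μ : ∀ i, Measure (α i)) [∀ i, SigmaFinite (μ i)] (ν : Measure (∀ i, α i)) {c : ENNReal}
    (hc : c ≠ 0) (hc' : c ≠ ⊤)
    (h : ∀ s : ∀ i, Set (α i), ν (Set.univ.pi s) ≤ c * ∏ i, μ i (s i)) :
    ν ≤ c • Measure.pi μ := by
  -- `OuterMeasure.pi` is the largest outer measure bounded on boxes by the product of the factors,
  -- so the constant is moved to the side of `ν`.
  have key : c⁻¹ • ν.toOuterMeasure ≤ OuterMeasure.pi fun i => (μ i).toOuterMeasure := by
    refine OuterMeasure.le_pi.2 fun s _ => ?_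
    simp only [_root_.smul_apply, smul_eq_mul, Measure.toOuterMeasure_apply]
    rw [mul_comm, ← div_eq_mul_inv]
    exact ENNReal.div_le_of_le_mul' (h s)
  refine Measure.le_iff.2 fun s hs => ?_
  have h1 := key s
  simp only [_root_.smul_apply, smul_eq_mul, Measure.toOuterMeasure_apply] at h1
  have h2 : Measure.pi μ s = OuterMeasure.pi (fun i => (μ i).toOuterMeasure) s := by
    rw [Measure.pi_def, toMeasure_apply _ _ hs]
  rw [Measure.smul_apply, smul_eq_mul, h2]
  rw [mul_comm, ← div_eq_mul_inv] at h1
  exact (ENNReal.div_le_iff' hc hc').1 h1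

/-! ### Laplace noise under translation -/

theorem measurable_laplaceDensity (lam : ℝ) :
    Measurable fun z : ℝ => ENNReal.ofReal (1 / (2 * lam) * Real.exp (-|z| / lam)) := by
  fun_prop

instance sigmaFinite_laplace (lam : ℝ) : SigmaFinite (laplace lam) := by
  unfold laplace
  exact SigmaFinite.withDensity_ofReal _

/-- Translating the Laplace distribution by `t` changes it by a factor of at most
`exp (|t| / lam)`. -/
theorem map_add_laplace_le {lam : ℝ} (hlam : 0 < lam) (t : ℝ) :
    (laplace lam).map (fun z => t + z) ≤
      ENNReal.ofReal (Real.exp (|t| / lam)) • laplace lam := by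
  refine Measure.le_iff.2 fun s hs => ?_
  have hmeas : Measurable fun z : ℝ => t + z := measurable_const_add t
  rw [Measure.map_apply hmeas hs, laplace, withDensity_apply _ (hmeas hs), Measure.smul_apply,
    withDensity_apply _ hs, smul_eq_mul,
    ← lintegral_const_mul _ (measurable_laplaceDensity lam)]
  have hshift : ∫⁻ z in (fun z => t + z) ⁻¹' s,
      ENNReal.ofReal (1 / (2 * lam) * Real.exp (-|z| / lam)) =
      ∫⁻ z in s, ENNReal.ofReal (1 / (2 * lam) * Real.exp (-|z - t| / lam)) := by
    rw [← (measurePreserving_add_left volume t).setLIntegral_comp_preimage hs (by fun_prop)]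
    simp
  rw [hshift]
  refine lintegral_mono fun z => ?_
  rw [← ENNReal.ofReal_mul (Real.exp_pos _).le]
  refine ENNReal.ofReal_le_ofReal ?_
  rw [mul_left_comm, ← Real.exp_add, ← add_div]
  have : |z| - |t| ≤ |z - t| := abs_sub_abs_le_abs_sub z t
  gcongr
  linarith

/-- The Laplace mechanism: for noise of scale `lam` in every coordinate, translation by `t` changes
the probability of any set by a factor of at most `exp (‖t‖₁ / lam)`. -/
theorem pi_laplace_preimage_add_le {ι : Type*} [Fintype ι] {lam : ℝ} (hlam : 0 < lam)
    (t : ι → ℝ) (A : Set (ι → ℝ)) :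
    Measure.pi (fun _ : ι => laplace lam) ((fun g => t + g) ⁻¹' A) ≤
      ENNReal.ofReal (Real.exp ((∑ i, |t i|) / lam)) *
        Measure.pi (fun _ : ι => laplace lam) A := by
  -- Translation is a measurable equivalence, so this holds for every set, and `A` need not be
  -- measurable.
  have hmap : ∀ B : Set (ι → ℝ),
      (Measure.pi fun _ : ι => laplace lam).map (fun g => t + g) B =
        Measure.pi (fun _ : ι => laplace lam) ((fun g => t + g) ⁻¹' B) := fun B =>
    (MeasurableEquiv.addLeft t).map_apply B
  have hle := Measure.le_smul_pi (fun _ : ι => laplace lam)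
    ((Measure.pi fun _ : ι => laplace lam).map (fun g => t + g))
    (c := ENNReal.ofReal (Real.exp ((∑ i, |t i|) / lam)))
    (by simpa using Real.exp_pos _) ENNReal.ofReal_ne_top (fun s => by
      rw [hmap]
      have hpre : (fun g => t + g) ⁻¹' Set.univ.pi s =
          Set.univ.pi fun i => (fun z => t i + z) ⁻¹' s i := by
        ext g; simp
      rw [hpre, Measure.pi_pi, Finset.sum_div, Real.exp_sum,
        ENNReal.ofReal_prod_of_nonneg fun i _ => (Real.exp_pos _).le, ← Finset.prod_mul_distrib]
      refine Finset.prod_le_prod' fun i _ => ?_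
      refine le_trans (le_of_eq ?_) (map_add_laplace_le hlam (t i) (s i))
      exact ((MeasurableEquiv.addLeft (t i)).map_apply (s i)).symm)
  rw [← hmap]
  exact hle A

/-- Post-processing of the Laplace mechanism, with independent extra noise that is ignored. -/
theorem oneshotNoise_laplace_mechanism {m : ℕ} {lam : ℝ} (hlam : 0 < lam) (x x' : Fin m → ℝ)
    (A : Set (Fin m → ℝ)) :
    oneshotNoise m lam {ω | (fun a => x a + ω.1 a) ∈ A} ≤
      ENNReal.ofReal (Real.exp ((∑ i, |x i - x' i|) / lam)) *
        oneshotNoise m lam {ω | (fun a => x' a + ω.1 a) ∈ A} := by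
  have hprod : ∀ y : Fin m → ℝ,
      {ω : (Fin m → ℝ) × (Fin m → ℝ) | (fun a => y a + ω.1 a) ∈ A} =
        ((fun g => y + g) ⁻¹' A) ×ˢ Set.univ := fun y => by
    ext ω; simp [Pi.add_def]
  have hshift : (fun g => x + g) ⁻¹' A =
      (fun g => (x - x') + g) ⁻¹' ((fun g => x' + g) ⁻¹' A) := by
    ext g
    simp only [Set.mem_preimage]
    rw [show x' + (x - x' + g) = x + g by abel]
  rw [hprod, hprod, oneshotNoise, Measure.prod_prod, Measure.prod_prod, ← mul_assoc, hshift]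
  gcongr
  exact pi_laplace_preimage_add_le hlam (x - x') _

/-! ### Ergodicity coefficient and perturbation of stationary distributions -/

theorem bddAbove_ergodicityCoeff {m : ℕ} (A : Matrix (Fin m) (Fin m) ℝ) :
    BddAbove {r | ∃ v : Fin m → ℝ, ∑ i, |v i| = 1 ∧ ∑ i, v i = 0 ∧ r = ∑ j, |(v ᵥ* A) j|} := by
  refine ⟨∑ j, ∑ i, |A i j|, ?_⟩
  rintro r ⟨v, hv, -, rfl⟩
  refine Finset.sum_le_sum fun j _ => ?_
  refine (Finset.abs_sum_le_sum_abs (fun i => v i * A i j) Finset.univ).trans (Finset.sum_le_sum fun i _ => ?_)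
  rw [abs_mul]
  refine mul_le_of_le_one_left (abs_nonneg _) ?_
  rw [← hv]
  exact Finset.single_le_sum (f := fun i => |v i|) (fun i _ => abs_nonneg (v i))
    (Finset.mem_univ i)

/-- By homogeneity, normalise `v` to `ℓ¹` norm one. The case `v = 0` is separate; for `m ≤ 1` it is
the only one, the supremum then being over the empty set. -/
theorem sum_abs_vecMul_le {m : ℕ} (A : Matrix (Fin m) (Fin m) ℝ) {v : Fin m → ℝ}
    (hv : ∑ i, v i = 0) :
    ∑ j, |(v ᵥ* A) j| ≤ ergodicityCoeff A * ∑ i, |v i| := by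
  set c := ∑ i, |v i| with hc
  have hc0 : 0 ≤ c := Finset.sum_nonneg fun _ _ => abs_nonneg _
  rcases hc0.eq_or_lt with h0 | hpos
  · have hz : v = 0 := by
      funext i
      have := (Finset.sum_eq_zero_iff_of_nonneg fun i _ => abs_nonneg (v i)).1 (hc.symm.trans h0.symm)
      simpa using this i (Finset.mem_univ i)
    rw [← h0, hz]
    simp
  · have hmem : ∑ j, |((c⁻¹ • v) ᵥ* A) j| ≤ ergodicityCoeff A := by
      refine le_csSup (bddAbove_ergodicityCoeff A) ⟨c⁻¹ • v, ?_, ?_, rfl⟩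
      · simp only [Pi.smul_apply, smul_eq_mul, abs_mul, ← Finset.mul_sum, ← hc,
          abs_of_pos (inv_pos.2 hpos)]
        exact inv_mul_cancel₀ hpos.ne'
      · simp only [Pi.smul_apply, smul_eq_mul, ← Finset.mul_sum, hv, mul_zero]
    simp only [Matrix.smul_vecMul, Pi.smul_apply, smul_eq_mul, abs_mul, ← Finset.mul_sum,
      abs_of_pos (inv_pos.2 hpos)] at hmem
    rwa [inv_mul_le_iff₀ hpos, mul_comm] at hmem

/-- Perturbation bound for stationary distributions in terms of the ergodicity coefficient. -/
theorem sum_abs_stationary_sub_le {m : ℕ} {P P' : Matrix (Fin m) (Fin m) ℝ} {π π' : Fin m → ℝ}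
    (hπ : IsStationaryDist P π) (hπ' : IsStationaryDist P' π') :
    (1 - ergodicityCoeff P) * ∑ i, |π' i - π i| ≤ ∑ j, |(π' ᵥ* (P' - P)) j| := by
  have hsum : ∑ i, (π' - π) i = 0 := by
    simp [hπ.1.2, hπ'.1.2]
  -- Only the coefficient of `P` enters, which is why one constrained data set of the two suffices.
  have heq : π' - π = π' ᵥ* (P' - P) + (π' - π) ᵥ* P := by
    rw [Matrix.vecMul_sub, Matrix.sub_vecMul, hπ.2, hπ'.2]
    abel
  have htri : ∑ i, |(π' - π) i| ≤
      ∑ j, |(π' ᵥ* (P' - P)) j| + ∑ j, |((π' - π) ᵥ* P) j| := by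
    rw [← Finset.sum_add_distrib]
    refine Finset.sum_le_sum fun j _ => ?_
    conv_lhs => rw [heq]
    exact abs_add_le _ _
  have := sum_abs_vecMul_le P hsum
  simp only [Pi.sub_apply] at htri this
  linarith

/-! ### Sensitivity of the transition matrix to one sample -/

namespace ComparisonData

variable {m : ℕ} {G : SimpleGraph (Fin m)} {L : ℕ}

theorem Adjacent.symm {D D' : ComparisonData G L} (h : D.Adjacent D') : D'.Adjacent D := by
  obtain ⟨e₀, l₀, h⟩ := h
  exact ⟨e₀, l₀, fun e l => ne_comm.trans (h e l)⟩

open Classical in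
theorem abs_mean_sub_le {D D' : ComparisonData G L} {e₀ : G.Dart} {l₀ : Fin L}
    (h : ∀ e l, D.outcome e l ≠ D'.outcome e l ↔ e.edge = e₀.edge ∧ l = l₀) (e : G.Dart) :
    |D'.mean e - D.mean e| ≤ if e.edge = e₀.edge then 1 / (L : ℝ) else 0 := by
  have hterm : ∀ l, |((if D'.outcome e l then 1 else 0 : ℝ)) - if D.outcome e l then 1 else 0| ≤
      if l = l₀ then (if e.edge = e₀.edge then 1 else 0) else 0 := fun l => by
    by_cases heq : D.outcome e l = D'.outcome e l
    · rw [heq, sub_self, abs_zero]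
      split_ifs <;> norm_num
    · obtain ⟨h1, h2⟩ := (h e l).1 heq
      rw [if_pos h2, if_pos h1]
      split_ifs <;> norm_num
  rw [mean, mean, ← mul_sub, ← Finset.sum_sub_distrib, abs_mul, abs_of_nonneg (by positivity)]
  calc _ ≤ 1 / (L : ℝ) * ∑ l, if l = l₀ then (if e.edge = e₀.edge then 1 else 0) else 0 := by
        gcongr
        exact (Finset.abs_sum_le_sum_abs _ _).trans (Finset.sum_le_sum fun l _ => hterm l)
    _ = _ := by simp

/-- Adjacent data sets differ in at most one off-diagonal entry of every row, by at most
`1 / (d L)`. -/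
theorem Adjacent.sum_abs_offDiag_sub_le {D D' : ComparisonData G L} (h : D.Adjacent D') {d : ℝ}
    (hd : 0 < d) (i : Fin m) :
    ∑ j, |D'.offDiag d i j - D.offDiag d i j| ≤ 1 / (d * L) := by
  classical
  obtain ⟨e₀, l₀, h⟩ := h
  have hterm : ∀ j, |D'.offDiag d i j - D.offDiag d i j| ≤
      if s(i, j) = e₀.edge then 1 / (d * L) else 0 := fun j => by
    by_cases hij : G.Adj i j
    · simp only [offDiag, hij, dif_pos]
      rw [← mul_sub, abs_mul, abs_of_pos (one_div_pos.2 hd)]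
      calc _ ≤ 1 / d * (if s(i, j) = e₀.edge then 1 / (L : ℝ) else 0) := by
            gcongr
            exact abs_mean_sub_le h ⟨(i, j), hij⟩
        _ = _ := by split_ifs <;> simp [mul_comm]
    · simp only [offDiag, hij, dif_neg, not_false_eq_true, sub_self, abs_zero]
      split_ifs <;> positivity
  refine (Finset.sum_le_sum fun j _ => hterm j).trans ?_
  rw [← Finset.sum_filter, Finset.sum_const, nsmul_eq_mul]
  refine mul_le_of_le_one_left (by positivity) ?_
  have : (Finset.univ.filter fun j => s(i, j) = e₀.edge).card ≤ 1 :=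
    Finset.card_le_one.2 fun a ha b hb => by
      simp only [Finset.mem_filter, Finset.mem_univ, true_and] at ha hb
      exact Sym2.congr_right.1 (ha.trans hb.symm)
  exact_mod_cast this

/-- Mass balance: inflow to `j` minus outflow from `j`. This eliminates the diagonal, leaving only
entries that a sample changes directly. -/
theorem vecMul_transition (D : ComparisonData G L) (d : ℝ) (p : Fin m → ℝ) (j : Fin m) :
    (p ᵥ* D.transition d) j =
      p j + ∑ i, (p i * D.offDiag d i j - p j * D.offDiag d j i) := by
  have hdiag : D.offDiag d j j = 0 := by simp [offDiag]
  have hentry : ∀ i, p i * D.transition d i j =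
      (if i = j then p j * (1 - ∑ k, D.offDiag d j k) else 0) + p i * D.offDiag d i j := fun i => by
    by_cases hij : i = j
    · subst hij
      simp [transition, hdiag]
    · simp [transition, hij]
  simp only [Matrix.vecMul, dotProduct, hentry, Finset.sum_add_distrib, Finset.sum_sub_distrib,
    ← Finset.mul_sum, Finset.sum_ite_eq', Finset.mem_univ, if_true]
  ring

/-- Each change of flow is counted twice, at its source and at its target, hence the 2. The row
bounds 1/(dL) are averaged with the weights `p`, which sum to one. -/
theorem Adjacent.sum_abs_vecMul_transition_sub_le {D D' : ComparisonData G L}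
    (h : D.Adjacent D') {d : ℝ} (hd : 0 < d) {p : Fin m → ℝ} (hp : p ∈ stdSimplex ℝ (Fin m)) :
    ∑ j, |(p ᵥ* (D'.transition d - D.transition d)) j| ≤ 2 / (d * L) := by
  set Δ : Fin m → Fin m → ℝ := fun i j => D'.offDiag d i j - D.offDiag d i j with hΔ
  have hcoord : ∀ j, (p ᵥ* (D'.transition d - D.transition d)) j =
      ∑ i, (p i * Δ i j - p j * Δ j i) := fun j => by
    rw [Matrix.vecMul_sub, Pi.sub_apply, vecMul_transition, vecMul_transition,
      add_sub_add_left_eq_sub, ← Finset.sum_sub_distrib]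
    refine Finset.sum_congr rfl fun i _ => ?_
    simp only [hΔ]
    ring
  have hrow : ∑ j, ∑ i, p j * |Δ j i| ≤ 1 / (d * L) := by
    calc ∑ j, ∑ i, p j * |Δ j i| ≤ ∑ j, p j * (1 / (d * L)) := by
          refine Finset.sum_le_sum fun j _ => ?_
          rw [← Finset.mul_sum]
          exact mul_le_mul_of_nonneg_left (h.sum_abs_offDiag_sub_le hd j) (hp.1 j)
      _ = 1 / (d * L) := by rw [← Finset.sum_mul, hp.2, one_mul]
  calc ∑ j, |(p ᵥ* (D'.transition d - D.transition d)) j|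
      ≤ ∑ j, ∑ i, (p i * |Δ i j| + p j * |Δ j i|) := by
        refine Finset.sum_le_sum fun j _ => ?_
        rw [hcoord]
        refine (Finset.abs_sum_le_sum_abs _ _).trans (Finset.sum_le_sum fun i _ => ?_)
        refine (abs_sub _ _).trans (le_of_eq ?_)
        rw [abs_mul, abs_mul, abs_of_nonneg (hp.1 i), abs_of_nonneg (hp.1 j)]
    _ = 2 * ∑ j, ∑ i, p j * |Δ j i| := by
        simp only [Finset.sum_add_distrib]
        rw [Finset.sum_comm]
        ring
    _ ≤ 2 / (d * L) := by
        rw [show 2 / (d * L) = 2 * (1 / (d * L)) by ring]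
        gcongr

theorem HasUniqueStationary.isStationaryDist {D : ComparisonData G L} {d : ℝ}
    (h : D.HasUniqueStationary d) :
    IsStationaryDist (D.transition d) (stationaryDistribution (D.transition d)) :=
  Classical.epsilon_spec h.exists

/-- The `ℓ¹` sensitivity of the stationary distribution at a constrained data set. -/
theorem Adjacent.sum_abs_stationaryDistribution_sub_le {D D' : ComparisonData G L}
    (h : D.Adjacent D') {d ρ : ℝ} (hd : 0 < d) (hρ : ρ < 1) (hD : D.IsConstrained d ρ)
    (hD' : D'.HasUniqueStationary d) :
    ∑ i, |stationaryDistribution (D'.transition d) i - stationaryDistribution (D.transition d) i| ≤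
      2 / (d * L * (1 - ρ)) := by
  have h1 := sum_abs_stationary_sub_le hD.1.isStationaryDist hD'.isStationaryDist
  have h2 := h.sum_abs_vecMul_transition_sub_le hd hD'.isStationaryDist.1
  have hρ' : 0 < 1 - ρ := sub_pos.2 hρ
  rw [← div_div, le_div_iff₀ hρ', mul_comm]
  refine le_trans ?_ (h1.trans h2)
  have := hD.2
  gcongr

end ComparisonData

/-! ### Privacy of the spectral method -/

theorem theorem4 {m L k : ℕ} (hL : 0 < L) (hk : 1 ≤ k) (hkm : k ≤ m)
    (G : SimpleGraph (Fin m)) (d ρ ε δ lam : ℝ)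
    (hd : 0 < d) (hρ : ρ < 1)
    (hε : 0 < ε) (hε' : ε ≤ 0.2) (hδ : 0 < δ) (hδ' : δ ≤ 0.05)
    (hlam : 8 * (2 / (d * L * (1 - ρ))) * √(k * Real.log (m / δ)) / ε ≤ lam) :
    IsDifferentiallyPrivate (oneshotNoise m lam)
      (fun D D' : ComparisonData G L =>
        D.Adjacent D' ∧ D.HasUniqueStationary d ∧ D'.HasUniqueStationary d ∧
          (D.IsConstrained d ρ ∨ D'.IsConstrained d ρ))
      (ComparisonData.spectralOneshot hkm d) ε δ := by
  rintro D D' ⟨hadj, hu, hu', hcon⟩ S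
  set s : ℝ := 2 / (d * L * (1 - ρ)) with hs_def
  have hρ' : 0 < 1 - ρ := sub_pos.2 hρ
  have hLpos : (0 : ℝ) < L := by exact_mod_cast hL
  have hs : 0 < s := by positivity
  have hk1 : (1 : ℝ) ≤ k := by exact_mod_cast hk
  have hm1 : (1 : ℝ) ≤ m := by exact_mod_cast hk.trans hkm
  -- Here m/δ ≥ 20 > e.
  have hlog : 1 ≤ Real.log (m / δ) := by
    rw [Real.le_log_iff_exp_le (by positivity), le_div_iff₀ hδ]
    nlinarith [Real.exp_one_lt_d9, Real.exp_pos 1]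
  have hsqrt : 1 ≤ √(k * Real.log (m / δ)) :=
    Real.one_le_sqrt.2 (one_le_mul_of_one_le_of_one_le hk1 hlog)
  have hsε : s / ε ≤ lam := by
    refine le_trans ?_ hlam
    gcongr
    nlinarith
  have hlam0 : 0 < lam := (div_pos hs hε).trans_le hsε
  have hsens : ∑ i, |(-stationaryDistribution (D.transition d) i) -
      (-stationaryDistribution (D'.transition d) i)| ≤ s := by
    -- The `ℓ¹` distance and adjacency are symmetric, so either data set may play the constrained
    -- one.
    rcases hcon with hc | hc
    · refine le_trans (le_of_eq ?_) (hadj.sum_abs_stationaryDistribution_sub_le hd hρ hc hu')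
      exact Finset.sum_congr rfl fun i _ => by rw [neg_sub_neg]
    · refine le_trans (le_of_eq ?_) (hadj.symm.sum_abs_stationaryDistribution_sub_le hd hρ hc hu)
      exact Finset.sum_congr rfl fun i _ => by rw [neg_sub_neg, abs_sub_comm]
  -- The event is the set of noisy vectors whose `k` smallest entries have index set in `S`.
  refine le_trans (oneshotNoise_laplace_mechanism hlam0
    (fun i => -stationaryDistribution (D.transition d) i)
    (fun i => -stationaryDistribution (D'.transition d) i)
    {y | (Finset.univ.image fun j : Fin k => Tuple.sort y (Fin.castLE hkm j)) ∈ S}) ?_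
  refine le_trans ?_ le_self_add
  refine mul_le_mul' (ENNReal.ofReal_le_ofReal (Real.exp_le_exp.2 ?_)) le_rfl
  rw [div_le_iff₀ hlam0]
  rw [div_le_iff₀ hε] at hsε
  linarith
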